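/- Let $d\ge 2$, let $\mathbb S^d\subset\mathbb R^{d+1}$ be the unit sphere with the surface measure $\sigma$ normalized by $\sigma(\mathbb S^d)=1$, and let $P_n^{(d)}$ be the generalized Legendre polynomial of degree $n$, i.e. $P_n^{(d)}(1)=1$ and the $P_n^{(d)}$ are orthogonal on $[-1,1]$ with respect to the weight $(1-t^2)^{d/2-1}$. For every $C>0$ there is a constant $C_d>0$, depending only on $d$ and $C$, with the following property. Let $K_d$ be a continuous function on $[-1,1]$ given there by $$K_d(t)=\sum_{n=0}^\infty a_nP_n^{(d)}(t),\qquad a_n\ge 0 .$$ Let $\{A_i\}_{i=1}^N$ be an area-regular partition of $\mathbb S^d$, that is, the (measurable) sets $A_i$ are pairwise disjoint, $\mathbb S^d=\bigcup_{i=1}^N A_i$ and $\sigma(A_i)=\frac1N$, and suppose that $\operatorname{diam}(A_i)\le CN^{-1/d}$ for $i=1,\dots,N$ (Euclidean distance). Let $\sigma_i^*(\cdot)=N\,\sigma(A_i\cap\cdot)$ be the uniform distribution on $A_i$, and let $$E(K_d,X_N)=\frac1{N^2}\sum_{i,j=1}^N K_d(\langle \mathbf x_i,\mathbf x_j\rangle),\qquad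 X_N=\{\mathbf x_1,\dots,\mathbf x_N\}.$$ Then $\sum_n a_n<\infty$, the energy is integrable, and $$\int_{A_1}\!\cdots\!\int_{A_N}E(K_d,X_N)\,d\sigma_1^*(\mathbf x_1)\cdots d\sigma_N^*(\mathbf x_N)-a_0\le\frac{C_d}{N}\Bigg(N^{-2/d}\sum_{n=1}^{[N^{1/d}]}a_nn^2+\sum_{n=[N^{1/d}]+1}^\infty a_n\Bigg),$$ where $[\cdot]$ denotes the integer part. -/

import Mathlib

open scoped ENNReal

/-- The generalized Legendre polynomials `P_n^{(d)}` through their three-term recurrence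
`(n + d) P_{n+2} = (2n + d + 1) X P_{n+1} - (n + 1) P_n`, `P_0 = 1`, `P_1 = X`.
That this is the family with `deg P_n = n`, `P_n(1) = 1`, orthogonal on `[-1,1]` with respect to the
weight `(1 - t^2)^(d/2 - 1)` is `genLegendre_isGenLegendreFamily` below. -/
noncomputable def genLegendre (d : ℕ) : ℕ → Polynomial ℝ
  | 0 => 1
  | 1 => Polynomial.X
  | n + 2 => Polynomial.C (1 / ((n : ℝ) + d)) *
      (Polynomial.C (2 * (n : ℝ) + d + 1) * Polynomial.X * genLegendre d (n + 1)
        - Polynomial.C ((n : ℝ) + 1) * genLegendre d n)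

/-- The defining properties of the generalized Legendre polynomials: exact degree `n`,
normalization at `1`, orthogonality on `[-1,1]` with weight `(1 - t^2)^(d/2 - 1)`. -/
def IsGenLegendreFamily (d : ℕ) (P : ℕ → Polynomial ℝ) : Prop :=
  (∀ n, (P n).natDegree = n) ∧ (∀ n, (P n).eval 1 = 1) ∧
  ∀ m n, m ≠ n →
    ∫ t in (-1 : ℝ)..1, (P m).eval t * (P n).eval t * (1 - t ^ 2) ^ ((d : ℝ) / 2 - 1) = 0

section GenLegendreFacts

open Polynomial

theorem genLegendre_rec {d : ℕ} (hd : 2 ≤ d) (n : ℕ) :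
    C ((n : ℝ) + d) * genLegendre d (n + 2) =
      C (2 * (n : ℝ) + d + 1) * X * genLegendre d (n + 1) - C ((n : ℝ) + 1) * genLegendre d n := by
  have h0 : ((n : ℝ) + d) ≠ 0 := by positivity
  rw [genLegendre, ← mul_assoc, ← C_mul, mul_one_div_cancel h0, C_1, one_mul]

theorem genLegendre_eval_one {d : ℕ} (hd : 2 ≤ d) (n : ℕ) : (genLegendre d n).eval 1 = 1 := by
  induction n using Nat.strong_induction_on with
  | _ n ih =>
    match n with
    | 0 => simp [genLegendre]
    | 1 => simp [genLegendre]
    | n + 2 =>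
      have h := congrArg (eval 1) (genLegendre_rec hd n)
      have h0 : ((n : ℝ) + d) ≠ 0 := by positivity
      simp only [eval_mul, eval_sub, eval_C, eval_X, ih (n + 1) (by omega), ih n (by omega)] at h
      apply mul_left_cancel₀ h0
      linarith

theorem genLegendre_natDegree_aux {d : ℕ} (hd : 2 ≤ d) (n : ℕ) :
    (genLegendre d n).natDegree ≤ n ∧ 0 < (genLegendre d n).coeff n := by
  induction n using Nat.strong_induction_on with
  | _ n ih =>
    match n with
    | 0 => simp [genLegendre]
    | 1 => simp [genLegendre]
    | n + 2 =>
      obtain ⟨h1, h1'⟩ := ih (n + 1) (by omega)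
      obtain ⟨h2, -⟩ := ih n (by omega)
      have hz : (genLegendre d n).coeff (n + 2) = 0 :=
        coeff_eq_zero_of_natDegree_lt (by omega)
      constructor
      · rw [natDegree_le_iff_coeff_eq_zero]
        intro k hk
        obtain ⟨k, rfl⟩ : ∃ j, k = j + 1 := ⟨k - 1, by omega⟩
        rw [genLegendre, coeff_C_mul, coeff_sub, mul_assoc, coeff_C_mul, coeff_C_mul, coeff_X_mul,
          coeff_eq_zero_of_natDegree_lt (p := genLegendre d (n + 1)) (by omega),
          coeff_eq_zero_of_natDegree_lt (p := genLegendre d n) (by omega)]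
        simp
      · rw [genLegendre, coeff_C_mul, coeff_sub, mul_assoc, coeff_C_mul, coeff_C_mul, coeff_X_mul,
          hz]
        simp only [mul_zero, sub_zero]
        positivity

theorem genLegendre_deriv {d : ℕ} (hd : 2 ≤ d) (n : ℕ) :
    (1 - X ^ 2) * derivative (genLegendre d n) =
        C ((n : ℝ) + d - 1) * (X * genLegendre d n - genLegendre d (n + 1)) ∧
      (1 - X ^ 2) * derivative (genLegendre d (n + 1)) =
        C ((n : ℝ) + 1) * (genLegendre d n - X * genLegendre d (n + 1)) := by
  induction n with
  | zero => constructor <;> simp [genLegendre] <;> ring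
  | succ n ih =>
    obtain ⟨hB, hA⟩ := ih
    have hr := genLegendre_rec hd n
    have hd' := congrArg derivative hr
    have h0 : (C ((n : ℝ) + d)) ≠ 0 := by
      rw [Ne, C_eq_zero]; positivity
    simp only [derivative_mul, derivative_sub, derivative_C, derivative_X, zero_mul, zero_add,
      mul_one] at hd'
    constructor
    · rw [hA]
      push_cast at *
      simp only [C_add, C_sub, C_mul, C_1, map_natCast, map_ofNat] at *
      linear_combination hr
    · apply mul_left_cancel₀ h0
      push_cast at *
      simp only [C_add, C_sub, C_mul, C_1, map_natCast, map_ofNat] at *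
      linear_combination (1 - X ^ 2) * hd' + (2 * (n : ℝ[X]) + d + 1) * X * hA
        - ((n : ℝ[X]) + 1) * hB + ((n : ℝ[X]) + 2) * X * hr

theorem genLegendre_ode {d : ℕ} (hd : 2 ≤ d) (n : ℕ) :
    (1 - X ^ 2) * derivative (derivative (genLegendre d n))
      - C (d : ℝ) * X * derivative (genLegendre d n)
      + C ((n : ℝ) * ((n : ℝ) + d - 1)) * genLegendre d n = 0 := by
  cases n with
  | zero => simp [genLegendre]
  | succ n =>
    obtain ⟨hB, hA⟩ := genLegendre_deriv hd n
    have hw : (1 - X ^ 2 : ℝ[X]) ≠ 0 := by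
      intro h
      have := congrArg (eval 0) h
      simp at this
    have hA' := congrArg derivative hA
    simp only [derivative_mul, derivative_sub, derivative_C, derivative_X, zero_mul, zero_add,
      derivative_one, derivative_X_pow, one_mul] at hA'
    apply mul_left_cancel₀ hw
    push_cast at *
    simp only [C_add, C_sub, C_mul, C_1, map_natCast, map_ofNat] at *
    linear_combination (1 - X ^ 2) * hA' + ((n : ℝ[X]) + 1) * hB
      + (1 - d - n) * X * hA

theorem genLegendre_isGenLegendreFamily {d : ℕ} (hd : 2 ≤ d) :
    IsGenLegendreFamily d (genLegendre d) := by
  refine ⟨fun n => ?_, genLegendre_eval_one hd, fun m n hmn => ?_⟩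
  · obtain ⟨h1, h2⟩ := genLegendre_natDegree_aux hd n
    exact le_antisymm h1 (le_natDegree_of_ne_zero h2.ne')
  · set p := genLegendre d m
    set q := genLegendre d n
    have hd2 : (1 : ℝ) ≤ (d : ℝ) / 2 := by
      have : (2 : ℝ) ≤ d := by exact_mod_cast hd
      linarith
    have hl : (m : ℝ) * ((m : ℝ) + d - 1) - (n : ℝ) * ((n : ℝ) + d - 1) ≠ 0 := by
      have h1 : (m : ℝ) - n ≠ 0 := sub_ne_zero.2 (by exact_mod_cast hmn)
      have h2 : (m : ℝ) + n + d - 1 ≠ 0 := by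
        have : (0 : ℝ) ≤ m + n := by positivity
        intro h
        linarith
      intro h
      apply mul_ne_zero h1 h2
      linear_combination h
    have hderiv : ∀ t ∈ Set.uIcc (-1 : ℝ) 1,
        HasDerivAt (fun t : ℝ => (1 - t ^ 2) ^ ((d : ℝ) / 2) *
            ((derivative q).eval t * p.eval t - (derivative p).eval t * q.eval t))
          (((m : ℝ) * ((m : ℝ) + d - 1) - (n : ℝ) * ((n : ℝ) + d - 1)) *
            (p.eval t * q.eval t * (1 - t ^ 2) ^ ((d : ℝ) / 2 - 1))) t := by
      intro t ht
      rw [Set.uIcc_of_le (by norm_num)] at ht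
      have hw : (0 : ℝ) ≤ 1 - t ^ 2 := by nlinarith [ht.1, ht.2]
      have hpow : (1 - t ^ 2) ^ ((d : ℝ) / 2) = (1 - t ^ 2) * (1 - t ^ 2) ^ ((d : ℝ) / 2 - 1) := by
        rw [← Real.rpow_one_add' hw (by linarith)]
        congr 1
        ring
      have hb : HasDerivAt (fun t : ℝ => 1 - t ^ 2) (-(2 * t)) t := by
        simpa using ((hasDerivAt_id t).pow 2).const_sub 1
      have h1 := hb.rpow_const (p := (d : ℝ) / 2) (Or.inr hd2)
      have h2 := ((derivative q).hasDerivAt t).mul (p.hasDerivAt t)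
      have h3 := ((derivative p).hasDerivAt t).mul (q.hasDerivAt t)
      have ep := congrArg (eval t) (genLegendre_ode hd m)
      have eq := congrArg (eval t) (genLegendre_ode hd n)
      simp only [eval_add, eval_sub, eval_mul, eval_C, eval_X, eval_one, eval_pow, eval_zero]
        at ep eq
      refine (h1.mul (h2.sub h3)).congr_deriv ?_
      simp only [Pi.sub_apply, Pi.mul_apply]
      rw [hpow]
      linear_combination (1 - t ^ 2) ^ ((d : ℝ) / 2 - 1) * (p.eval t * eq - q.eval t * ep)
    have hcont : Continuous fun t : ℝ =>
        (((m : ℝ) * ((m : ℝ) + d - 1) - (n : ℝ) * ((n : ℝ) + d - 1)) *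
            (p.eval t * q.eval t * (1 - t ^ 2) ^ ((d : ℝ) / 2 - 1))) := by
      have hr : Continuous fun t : ℝ => (1 - t ^ 2) ^ ((d : ℝ) / 2 - 1) :=
        (by fun_prop : Continuous fun t : ℝ => 1 - t ^ 2).rpow_const
          (fun _ => Or.inr (by linarith))
      exact continuous_const.mul ((p.continuous.mul q.continuous).mul hr)
    have hF := intervalIntegral.integral_eq_sub_of_hasDerivAt hderiv
      (hcont.intervalIntegrable _ _)
    rw [intervalIntegral.integral_const_mul] at hF
    have h0 : (0 : ℝ) ^ ((d : ℝ) / 2) = 0 := Real.zero_rpow (by linarith)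
    norm_num [h0] at hF
    rcases hF with hF | hF
    · exact absurd hF hl
    · exact hF

end GenLegendreFacts

/-- The unit sphere `S^d` in `ℝ^(d+1)`, with the chordal (Euclidean) distance. -/
abbrev USphere (d : ℕ) : Type := Metric.sphere (0 : EuclideanSpace ℝ (Fin (d + 1))) 1

/-- The surface measure on `S^d`, normalized to total mass one. -/
noncomputable def sphereSigma (d : ℕ) : MeasureTheory.Measure (USphere d) :=
  ((MeasureTheory.volume : MeasureTheory.Measure
      (EuclideanSpace ℝ (Fin (d + 1)))).toSphere Set.univ)⁻¹ •
    (MeasureTheory.volume : MeasureTheory.Measure (EuclideanSpace ℝ (Fin (d + 1)))).toSphere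

instance sphereSigma_isProbabilityMeasure (d : ℕ) :
    MeasureTheory.IsProbabilityMeasure (sphereSigma d) := by
  constructor
  rw [sphereSigma, MeasureTheory.Measure.smul_apply, smul_eq_mul]
  apply ENNReal.inv_mul_cancel
  · rw [MeasureTheory.Measure.toSphere_apply_univ]
    refine mul_ne_zero (by simp) ?_
    exact (Metric.measure_ball_pos _ _ one_pos).ne'
  · exact MeasureTheory.measure_ne_top _ _

/-- An area-regular partition of `S^d` into `N` regions. -/
structure IsAreaRegularPartition (d N : ℕ) (A : Fin N → Set (USphere d)) : Prop where
  measurable : ∀ i, MeasurableSet (A i)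
  covers : ⋃ i, A i = Set.univ
  disjoint : ∀ i j, i ≠ j → A i ∩ A j = ∅
  area : ∀ i, sphereSigma d (A i) = (N : ℝ≥0∞)⁻¹

/-- The uniform distribution `σ_i^*(B) = N σ(A_i ∩ B)` on a region of area `1/N`. -/
noncomputable def regionMeasure (d N : ℕ) (Ai : Set (USphere d)) :
    MeasureTheory.Measure (USphere d) :=
  (N : ℝ≥0∞) • (sphereSigma d).restrict Ai

/-- The normalized energy `E(K, X_N) = N⁻² ∑_{i,j} K(⟨x_i, x_j⟩)`, diagonal included. -/
noncomputable def energy (d N : ℕ) (K : ℝ → ℝ) (x : Fin N → USphere d) : ℝ :=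
  1 / (N : ℝ) ^ 2 * ∑ i, ∑ j,
    K (inner ℝ (x i : EuclideanSpace ℝ (Fin (d + 1))) (x j : EuclideanSpace ℝ (Fin (d + 1))))

/-- The law of a jittered sample: independent points, the `i`-th one uniform in `A i`. -/
noncomputable def jitteredLaw (d N : ℕ) (A : Fin N → Set (USphere d)) :
    MeasureTheory.Measure (Fin N → USphere d) :=
  MeasureTheory.Measure.pi fun i => regionMeasure d N (A i)

/-!
By independence, only the diagonal terms distinguish the expected energy from the energy of the
uniform distribution:
`∫ E = ∬ K⟨x, y⟩ dσ dσ + N⁻² ∑ᵢ ∬ (K(1) - K⟨x, y⟩) dσᵢ* dσᵢ*`.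

The first term is `a₀`, because `Pₙ` has mean zero on the sphere for `n ≥ 1`: with `D = d/dt`, it is
an eigenfunction of `L = (1 - t²) D² - d t D` with nonzero eigenvalue, and every `L p` has mean
zero. The latter is a recurrence between the moments of `u ↦ ⟨y, u⟩`, which comes from integrating
`⟨y, x⟩ ^ k exp (-‖x‖²)` by parts on `ℝ^(d+1)` and passing to polar coordinates.

In the second term `1 - ⟨x, y⟩ = |x - y|² / 2 ≤ diam(Aᵢ)² / 2`, and `1 - Pₙ(t)` is at most both
`n² (1 - t)` and `2` on `[-1, 1]`, since `|Pₙ| ≤ 1` and `|D Pₙ| ≤ |D Pₙ(1)| ≤ n²`. The first bound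
serves the degrees `n ≤ N^(1/d)`, the second one the tail.
-/

section LegendreBounds

open Polynomial

/- Sonin's argument: `f ^ 2 + (1 - t ^ 2) * f' ^ 2 / μ` has derivative
`2 * (c - 1) * t * f' ^ 2 / μ ≥ 0`, and it equals `f ^ 2` at `t = 1`. -/
theorem abs_le_abs_one_of_gegenbauer_ode {f f' f'' : ℝ → ℝ} {c μ : ℝ} (hc : 1 ≤ c) (hμ : 0 < μ)
    (hf : ∀ t ∈ Set.Icc (0 : ℝ) 1, HasDerivWithinAt f (f' t) (Set.Icc 0 1) t)
    (hf' : ∀ t ∈ Set.Icc (0 : ℝ) 1, HasDerivWithinAt f' (f'' t) (Set.Icc 0 1) t)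
    (hode : ∀ t ∈ Set.Icc (0 : ℝ) 1, (1 - t ^ 2) * f'' t - c * t * f' t + μ * f t = 0)
    {t : ℝ} (ht : t ∈ Set.Icc (0 : ℝ) 1) : |f t| ≤ |f 1| := by
  set F : ℝ → ℝ := fun t => f t ^ 2 + (1 - t ^ 2) * f' t ^ 2 / μ with hF
  have hderiv : ∀ t ∈ Set.Icc (0 : ℝ) 1,
      HasDerivWithinAt F (2 * (c - 1) * t * f' t ^ 2 / μ) (Set.Icc 0 1) t := by
    intro t ht
    have hw : HasDerivWithinAt (fun t : ℝ => 1 - t ^ 2) (-(2 * t)) (Set.Icc 0 1) t := by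
      simpa using ((hasDerivWithinAt_id t _).pow 2).const_sub 1
    refine (((hf t ht).pow 2).add ((hw.mul ((hf' t ht).pow 2)).div_const μ)).congr_deriv ?_
    simp only [Pi.pow_apply]
    field_simp
    push_cast
    linear_combination 2 * f' t * hode t ht
  have hmono : MonotoneOn F (Set.Icc 0 1) :=
    monotoneOn_of_hasDerivWithinAt_nonneg (convex_Icc 0 1)
      (fun t ht => (hderiv t ht).continuousWithinAt)
      (fun t ht => (hderiv t (interior_subset ht)).mono interior_subset) fun t ht => by
        have : 0 ≤ t := (interior_subset ht).1
        have : 0 ≤ c - 1 := sub_nonneg.2 hc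
        positivity
  have hw : 0 ≤ 1 - t ^ 2 := by nlinarith [ht.1, ht.2]
  refine sq_le_sq.1 ?_
  calc f t ^ 2 ≤ F t := le_add_of_nonneg_right (by positivity)
    _ ≤ F 1 := hmono ht (Set.right_mem_Icc.2 zero_le_one) ht.2
    _ = f 1 ^ 2 := by simp [hF]

theorem abs_eval_abs_of_comp_neg_X {p : ℝ[X]} {n : ℕ} (hp : p.comp (-X) = (-1) ^ n * p) (t : ℝ) :
    |p.eval (|t|)| = |p.eval t| := by
  rcases abs_choice t with h | h
  · rw [h]
  · have h' := congrArg (fun q => |q.eval t|) hp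
    simpa [h, abs_mul] using h'

theorem derivative_comp_neg_X {p : ℝ[X]} {n : ℕ} (hp : p.comp (-X) = (-1) ^ n * p) :
    (derivative p).comp (-X) = (-1) ^ (n + 1) * derivative p := by
  have h := congrArg derivative hp
  have hc : derivative ((-1 : ℝ[X]) ^ n) = 0 := by
    simp [derivative_pow]
  rw [derivative_comp, derivative_mul, hc, derivative_neg, derivative_X] at h
  linear_combination -h

theorem genLegendre_comp_neg_X (d n : ℕ) :
    (genLegendre d n).comp (-X) = (-1) ^ n * genLegendre d n := by
  induction n using Nat.twoStepInduction with
  | zero => simp [genLegendre]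
  | one => simp [genLegendre]
  | more n ih ih' =>
    simp only [genLegendre, mul_comp, sub_comp, C_comp, X_comp, ih, ih']
    ring

variable {d : ℕ}

theorem genLegendre_eigenvalue_pos (hd : 2 ≤ d) {n : ℕ} (hn : n ≠ 0) :
    0 < (n : ℝ) * (n + d - 1) := by
  have h1 : (1 : ℝ) ≤ n := by exact_mod_cast Nat.one_le_iff_ne_zero.2 hn
  have h2 : (2 : ℝ) ≤ d := by exact_mod_cast hd
  exact mul_pos (by linarith) (by linarith)

theorem genLegendre_eval_ode (hd : 2 ≤ d) (n : ℕ) (t : ℝ) :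
    (1 - t ^ 2) * (derivative (derivative (genLegendre d n))).eval t
      - d * t * (derivative (genLegendre d n)).eval t
      + n * (n + d - 1) * (genLegendre d n).eval t = 0 := by
  simpa using congrArg (eval t) (genLegendre_ode hd n)

theorem derivative_genLegendre_eval_ode (hd : 2 ≤ d) (n : ℕ) (t : ℝ) :
    (1 - t ^ 2) * (derivative (derivative (derivative (genLegendre d n)))).eval t
      - (d + 2) * t * (derivative (derivative (genLegendre d n))).eval t
      + (n - 1) * (n + d) * (derivative (genLegendre d n)).eval t = 0 := by
  have h := congrArg (fun p => (derivative p).eval t) (genLegendre_ode hd n)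
  simp only [derivative_mul, derivative_add, derivative_sub, derivative_C, derivative_X,
    derivative_one, derivative_X_pow, derivative_zero, eval_add, eval_sub, eval_mul, eval_C,
    eval_X, eval_one, eval_pow, eval_zero] at h
  simp only [Nat.cast_ofNat, Nat.add_one_sub_one, pow_one, zero_sub, neg_mul, zero_mul, mul_one,
    zero_add] at h
  linear_combination h

theorem abs_genLegendre_eval_le_one (hd : 2 ≤ d) (n : ℕ) {t : ℝ} (ht : t ∈ Set.Icc (-1 : ℝ) 1) :
    |(genLegendre d n).eval t| ≤ 1 := by
  rcases eq_or_ne n 0 with rfl | hn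
  · simp [genLegendre]
  · have hd1 : (1 : ℝ) ≤ d := by exact_mod_cast one_le_two.trans hd
    have h := abs_le_abs_one_of_gegenbauer_ode hd1 (genLegendre_eigenvalue_pos hd hn)
      (fun s _ => ((genLegendre d n).hasDerivAt s).hasDerivWithinAt)
      (fun s _ => ((derivative (genLegendre d n)).hasDerivAt s).hasDerivWithinAt)
      (fun s _ => genLegendre_eval_ode hd n s) ⟨abs_nonneg t, abs_le.2 ht⟩
    rwa [abs_eval_abs_of_comp_neg_X (genLegendre_comp_neg_X d n), genLegendre_eval_one hd,
      abs_one] at h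

theorem derivative_genLegendre_eval_one (hd : 2 ≤ d) (n : ℕ) :
    (derivative (genLegendre d n)).eval 1 = n * (n + d - 1) / d := by
  have h := genLegendre_eval_ode hd n 1
  rw [genLegendre_eval_one hd] at h
  rw [eq_div_iff (by positivity)]
  linear_combination -h

theorem abs_derivative_genLegendre_eval_one_le (hd : 2 ≤ d) (n : ℕ) :
    |(derivative (genLegendre d n)).eval 1| ≤ (n : ℝ) ^ 2 := by
  rcases eq_or_ne n 0 with rfl | hn
  · simp [genLegendre]
  · have hn1 : (1 : ℝ) ≤ n := by exact_mod_cast Nat.one_le_iff_ne_zero.2 hn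
    have hd2 : (2 : ℝ) ≤ d := by exact_mod_cast hd
    have hpos := genLegendre_eigenvalue_pos hd hn
    rw [derivative_genLegendre_eval_one hd, abs_of_nonneg (by positivity),
      div_le_iff₀ (by positivity)]
    have h : 0 ≤ (n : ℝ) * (n - 1) * (d - 1) :=
      mul_nonneg (mul_nonneg (by linarith) (by linarith)) (by linarith)
    linarith

theorem abs_derivative_genLegendre_eval_le (hd : 2 ≤ d) (n : ℕ) {t : ℝ}
    (ht : t ∈ Set.Icc (-1 : ℝ) 1) : |(derivative (genLegendre d n)).eval t| ≤ (n : ℝ) ^ 2 := by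
  rcases lt_or_ge n 2 with hn | hn
  · interval_cases n <;> simp [genLegendre]
  · have hn2 : (2 : ℝ) ≤ n := by exact_mod_cast hn
    have hd2 : (2 : ℝ) ≤ d := by exact_mod_cast hd
    set q := derivative (genLegendre d n)
    have h := abs_le_abs_one_of_gegenbauer_ode (c := d + 2) (by linarith)
      (mul_pos (by linarith) (by linarith))
      (fun s _ => (q.hasDerivAt s).hasDerivWithinAt)
      (fun s _ => ((derivative q).hasDerivAt s).hasDerivWithinAt)
      (fun s _ => derivative_genLegendre_eval_ode hd n s) ⟨abs_nonneg t, abs_le.2 ht⟩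
    rw [abs_eval_abs_of_comp_neg_X (derivative_comp_neg_X (genLegendre_comp_neg_X d n))] at h
    exact h.trans (abs_derivative_genLegendre_eval_one_le hd n)

theorem one_sub_genLegendre_eval_le (hd : 2 ≤ d) (n : ℕ) {t : ℝ} (ht : t ∈ Set.Icc (-1 : ℝ) 1) :
    1 - (genLegendre d n).eval t ≤ (n : ℝ) ^ 2 * (1 - t) := by
  have h := (convex_Icc (-1 : ℝ) 1).norm_image_sub_le_of_norm_hasDerivWithin_le
    (fun s _ => ((genLegendre d n).hasDerivAt s).hasDerivWithinAt)
    (fun s hs => abs_derivative_genLegendre_eval_le hd n hs) ht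
    (Set.right_mem_Icc.2 (by norm_num))
  rw [genLegendre_eval_one hd, Real.norm_eq_abs, Real.norm_of_nonneg (sub_nonneg.2 ht.2)] at h
  exact (le_abs_self _).trans h

end LegendreBounds

section SphericalMoments

open MeasureTheory Set

theorem integral_pow_mul_exp_neg_sq (k : ℕ) :
    ∫ r in Ioi (0 : ℝ), r ^ k * Real.exp (-r ^ 2) = 1 / 2 * Real.Gamma ((k + 1) / 2) := by
  have h := integral_rpow_mul_exp_neg_rpow (p := 2) (q := k) two_pos
    ((neg_one_lt_zero).trans_le k.cast_nonneg)
  simpa [Real.rpow_natCast] using h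

theorem integral_pow_mul_exp_neg_sq_pos (k : ℕ) :
    0 < ∫ r in Ioi (0 : ℝ), r ^ k * Real.exp (-r ^ 2) := by
  rw [integral_pow_mul_exp_neg_sq]
  exact mul_pos one_half_pos (Real.Gamma_pos_of_pos (by positivity))

theorem integral_pow_add_two_mul_exp_neg_sq (k : ℕ) :
    ∫ r in Ioi (0 : ℝ), r ^ (k + 2) * Real.exp (-r ^ 2) =
      ((k : ℝ) + 1) / 2 * ∫ r in Ioi (0 : ℝ), r ^ k * Real.exp (-r ^ 2) := by
  have h : (((k + 2 : ℕ) : ℝ) + 1) / 2 = ((k : ℝ) + 1) / 2 + 1 := by push_cast; ring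
  rw [integral_pow_mul_exp_neg_sq, integral_pow_mul_exp_neg_sq, h,
    Real.Gamma_add_one (by positivity)]
  ring

variable {E : Type*} [NormedAddCommGroup E] [MeasurableSpace E] [BorelSpace E]

theorem integral_eq_integral_toSphere_mul_integral_Ioi [NormedSpace ℝ E] [FiniteDimensional ℝ E]
    [Nontrivial E] (μ : Measure E) [μ.IsAddHaarMeasure] {f : E → ℝ}
    {g : Metric.sphere (0 : E) 1 → ℝ} {h : ℝ → ℝ}
    (hf : ∀ u : Metric.sphere (0 : E) 1, ∀ r > 0, f (r • (u : E)) = g u * h r) :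
    ∫ x, f x ∂μ = (∫ u, g u ∂μ.toSphere) *
      ∫ r in Ioi (0 : ℝ), r ^ (Module.finrank ℝ E - 1) * h r := by
  calc ∫ x, f x ∂μ = ∫ x : ({0}ᶜ : Set E), f x ∂μ.comap (↑) := by
        rw [integral_subtype_comap (measurableSet_singleton _).compl f, restrict_compl_singleton]
    _ = ∫ p : Metric.sphere (0 : E) 1 × Ioi (0 : ℝ), g p.1 * h p.2
          ∂μ.toSphere.prod (.volumeIoiPow (Module.finrank ℝ E - 1)) := by
        rw [← μ.measurePreserving_homeomorphUnitSphereProd.integral_comp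
          (Homeomorph.measurableEmbedding _)]
        refine integral_congr_ae (.of_forall fun x => ?_)
        have hx : 0 < ‖(x : E)‖ := norm_pos_iff.2 x.2
        simp [← hf _ _ hx, smul_smul, hx.ne']
    _ = (∫ u, g u ∂μ.toSphere) *
          ∫ r : Ioi (0 : ℝ), h r ∂.volumeIoiPow (Module.finrank ℝ E - 1) :=
        integral_prod_mul g fun r : Ioi (0 : ℝ) => h r
    _ = _ := by
        congr 1
        rw [Measure.volumeIoiPow, integral_withDensity_eq_integral_toReal_smul
          (by fun_prop) (by simp), integral_subtype_comap measurableSet_Ioi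
          fun r : ℝ => (ENNReal.ofReal (r ^ (Module.finrank ℝ E - 1))).toReal • h r]
        refine setIntegral_congr_fun measurableSet_Ioi fun r (hr : 0 < r) => ?_
        simp only [smul_eq_mul]
        rw [ENNReal.toReal_ofReal (by positivity)]

variable [InnerProductSpace ℝ E] [FiniteDimensional ℝ E] [Nontrivial E] (μ : Measure E)
  [μ.IsAddHaarMeasure] (y : E)

theorem integrable_inner_pow_mul_exp_neg_sq (k : ℕ) :
    Integrable (fun x => inner ℝ y x ^ k * Real.exp (-‖x‖ ^ 2)) μ := by
  have h : Integrable (fun x => ‖y‖ ^ k * (‖x‖ ^ k * Real.exp (-‖x‖ ^ 2))) μ := by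
    refine Integrable.const_mul ?_ _
    rw [integrable_fun_norm_addHaar μ (f := fun r : ℝ => r ^ k * Real.exp (-r ^ 2))]
    have h := integrableOn_rpow_mul_exp_neg_mul_sq (b := 1) one_pos
      (s := (Module.finrank ℝ E - 1 + k : ℕ)) ((neg_one_lt_zero).trans_le (Nat.cast_nonneg _))
    simpa only [Real.rpow_natCast, pow_add, mul_assoc, neg_one_mul, smul_eq_mul] using h
  refine h.mono' (Continuous.aestronglyMeasurable (by fun_prop)) (.of_forall fun x => ?_)
  rw [norm_mul, norm_pow, Real.norm_of_nonneg (Real.exp_pos _).le, ← mul_assoc, ← mul_pow]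
  gcongr
  exact norm_inner_le_norm y x

theorem integral_inner_pow_add_two_mul_exp_neg_sq (k : ℕ) :
    2 * ∫ x, inner ℝ y x ^ (k + 2) * Real.exp (-‖x‖ ^ 2) ∂μ =
      (k + 1) * ‖y‖ ^ 2 * ∫ x, inner ℝ y x ^ k * Real.exp (-‖x‖ ^ 2) ∂μ := by
  have hf : ∀ x, HasFDerivAt (fun x => inner ℝ y x ^ (k + 1))
      (((k + 1 : ℕ) * inner ℝ y x ^ k : ℝ) • innerSL ℝ y) x := fun x => by
    simpa using (innerSL ℝ y).hasFDerivAt.pow (k + 1)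
  have hg : ∀ x : E, HasFDerivAt (fun x => Real.exp (-‖x‖ ^ 2))
      (Real.exp (-‖x‖ ^ 2) • -((2 : ℝ) • innerSL ℝ x)) x := fun x => by
    simpa [two_smul] using (hasStrictFDerivAt_norm_sq x).hasFDerivAt.fun_neg.exp
  have hf' : ∀ x, fderiv ℝ (fun x => inner ℝ y x ^ (k + 1)) x y * Real.exp (-‖x‖ ^ 2) =
      (k + 1) * ‖y‖ ^ 2 * (inner ℝ y x ^ k * Real.exp (-‖x‖ ^ 2)) := fun x => by
    rw [(hf x).fderiv]
    simp only [smul_apply, innerSL_apply_apply, real_inner_self_eq_norm_sq,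
      smul_eq_mul]
    push_cast
    ring
  have hg' : ∀ x, inner ℝ y x ^ (k + 1) * fderiv ℝ (fun x : E => Real.exp (-‖x‖ ^ 2)) x y =
      -2 * (inner ℝ y x ^ (k + 2) * Real.exp (-‖x‖ ^ 2)) := fun x => by
    rw [(hg x).fderiv]
    simp only [smul_apply, neg_apply,
      innerSL_apply_apply, real_inner_comm x y, smul_eq_mul]
    ring
  have hint := integrable_inner_pow_mul_exp_neg_sq μ y
  have h := integral_mul_fderiv_eq_neg_fderiv_mul_of_integrable (μ := μ) (v := y)
    (by simpa only [hf'] using (hint k).const_mul _)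
    (by simpa only [hg'] using (hint (k + 2)).const_mul _) (hint (k + 1))
    (fun x _ => (hf x).differentiableAt) fun x _ => (hg x).differentiableAt
  simp only [hf', hg', integral_const_mul] at h
  linarith

theorem integral_inner_toSphere : ∫ u, inner ℝ y u.1 ∂μ.toSphere = 0 := by
  have hodd : ∫ x, inner ℝ y x * Real.exp (-‖x‖ ^ 2) ∂μ = 0 := by
    have h := integral_neg_eq_self (fun x => inner ℝ y x * Real.exp (-‖x‖ ^ 2)) μ
    simp only [inner_neg_right, norm_neg, neg_mul, integral_neg] at h
    linarith
  rw [integral_eq_integral_toSphere_mul_integral_Ioi μ (g := fun u => inner ℝ y u.1)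
    (h := fun r => r * Real.exp (-r ^ 2)) fun u r hr => by
      simp only [inner_smul_right, norm_smul, Real.norm_eq_abs, abs_of_pos hr,
        norm_eq_of_mem_sphere, mul_one]
      ring] at hodd
  simp only [← mul_assoc, ← pow_succ] at hodd
  exact (mul_eq_zero.1 hodd).resolve_right (integral_pow_mul_exp_neg_sq_pos _).ne'

theorem integral_inner_pow_add_two_toSphere (k : ℕ) :
    (k + Module.finrank ℝ E) * ∫ u, inner ℝ y u.1 ^ (k + 2) ∂μ.toSphere =
      (k + 1) * ‖y‖ ^ 2 * ∫ u, inner ℝ y u.1 ^ k ∂μ.toSphere := by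
  have hpolar : ∀ j, ∫ x, inner ℝ y x ^ j * Real.exp (-‖x‖ ^ 2) ∂μ =
      (∫ u, inner ℝ y u.1 ^ j ∂μ.toSphere) *
        ∫ r in Ioi (0 : ℝ), r ^ (Module.finrank ℝ E - 1 + j) * Real.exp (-r ^ 2) := fun j => by
    simp only [pow_add, mul_assoc]
    refine integral_eq_integral_toSphere_mul_integral_Ioi μ fun u r hr => ?_
    simp only [inner_smul_right, norm_smul, Real.norm_eq_abs, abs_of_pos hr,
      norm_eq_of_mem_sphere, mul_one]
    ring
  have h := integral_inner_pow_add_two_mul_exp_neg_sq μ y k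
  rw [hpolar, hpolar, ← add_assoc, integral_pow_add_two_mul_exp_neg_sq] at h
  have hdim : ((Module.finrank ℝ E - 1 + k : ℕ) : ℝ) + 1 = k + Module.finrank ℝ E := by
    rw [← Nat.cast_add_one, ← Nat.cast_add, add_right_comm,
      Nat.sub_add_cancel Module.finrank_pos, add_comm]
  apply mul_right_cancel₀ (integral_pow_mul_exp_neg_sq_pos (Module.finrank ℝ E - 1 + k)).ne'
  rw [hdim] at h
  linear_combination h

end SphericalMoments

section LegendreExpansions

open MeasureTheory Polynomial Set

theorem integrable_of_continuous {α : Type*} [TopologicalSpace α] [CompactSpace α]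
    [MeasurableSpace α] [OpensMeasurableSpace α] {μ : Measure α} [IsFiniteMeasure μ] {f : α → ℝ}
    (hf : Continuous f) : Integrable f μ :=
  hf.integrable_of_hasCompactSupport (HasCompactSupport.of_compactSpace f)

variable {d : ℕ}

theorem sphere_inner_mem_Icc (x y : USphere d) : inner ℝ x.1 y.1 ∈ Icc (-1 : ℝ) 1 :=
  real_inner_mem_Icc_of_norm_eq_one (norm_eq_of_mem_sphere x) (norm_eq_of_mem_sphere y)

theorem one_sub_sphere_inner (x y : USphere d) : 1 - inner ℝ x.1 y.1 = dist x y ^ 2 / 2 := by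
  rw [Subtype.dist_eq, dist_eq_norm, norm_sub_sq_real, norm_eq_of_mem_sphere,
    norm_eq_of_mem_sphere]
  ring

theorem continuous_comp_sphere_inner {K : ℝ → ℝ} (hK : ContinuousOn K (Icc (-1) 1)) :
    Continuous fun p : USphere d × USphere d => K (inner ℝ p.1.1 p.2.1) :=
  hK.comp_continuous (by fun_prop) fun p => sphere_inner_mem_Icc p.1 p.2

/-- The mean over the sphere of the zonal function `u ↦ p ⟨y, u⟩` with pole `y`. -/
noncomputable def zonalMean (y : USphere d) : ℝ[X] →ₗ[ℝ] ℝ where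
  toFun p := ∫ u, p.eval (inner ℝ y.1 u.1) ∂sphereSigma d
  map_add' p q := by
    simp only [eval_add]
    exact integral_add (integrable_of_continuous (by fun_prop))
      (integrable_of_continuous (by fun_prop))
  map_smul' c p := by
    simp only [eval_smul, integral_smul, RingHom.id_apply]

theorem zonalMean_apply (y : USphere d) (p : ℝ[X]) :
    zonalMean y p = ∫ u, p.eval (inner ℝ y.1 u.1) ∂sphereSigma d :=
  rfl

theorem zonalMean_X (y : USphere d) : zonalMean y X = 0 := by
  simp only [zonalMean_apply, eval_X, sphereSigma, integral_smul_measure,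
    integral_inner_toSphere, smul_zero]

theorem zonalMean_X_pow_add_two (y : USphere d) (k : ℕ) :
    (k + 1 + d) * zonalMean y (X ^ (k + 2)) = (k + 1) * zonalMean y (X ^ k) := by
  have h := integral_inner_pow_add_two_toSphere
    (volume : Measure (EuclideanSpace ℝ (Fin (d + 1)))) y.1 k
  rw [norm_eq_of_mem_sphere, finrank_euclideanSpace_fin] at h
  push_cast at h
  simp only [zonalMean_apply, eval_pow, eval_X, sphereSigma, integral_smul_measure, smul_eq_mul]
  linear_combination (volume (α := EuclideanSpace ℝ (Fin (d + 1))).toSphere univ)⁻¹.toReal * h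

theorem zonalMean_gegenbauer_operator (y : USphere d) (p : ℝ[X]) :
    zonalMean y ((1 - X ^ 2) * derivative (derivative p) - C (d : ℝ) * X * derivative p) = 0 := by
  induction p using Polynomial.induction_on' with
  | add p q hp hq =>
    have hpq := (map_add (zonalMean y) _ _).trans (congrArg₂ (· + ·) hp hq)
    rw [add_zero] at hpq
    convert hpq using 2
    simp only [derivative_add]
    ring
  | monomial n c =>
    rw [← C_mul_X_pow_eq_monomial]
    match n with
    | 0 => simp
    | 1 =>
      have hX : (1 - X ^ 2) * derivative (derivative (C c * X ^ 1))
          - C (d : ℝ) * X * derivative (C c * X ^ 1) = (-(d * c)) • (X : ℝ[X]) := by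
        simp only [pow_one, derivative_mul, derivative_C, zero_mul, derivative_X, mul_one, zero_add,
          mul_zero, map_natCast, zero_sub, neg_smul, smul_eq_C_mul, map_mul]
        ring
      rw [hX, map_smul, zonalMean_X, smul_zero]
    | k + 2 =>
      have hX : (1 - X ^ 2) * derivative (derivative (C c * X ^ (k + 2)))
          - C (d : ℝ) * X * derivative (C c * X ^ (k + 2)) =
            (c * (k + 2)) • ((k + 1 : ℝ) • X ^ k - (k + 1 + d : ℝ) • X ^ (k + 2)) := by
        simp only [derivative_mul, derivative_C, zero_mul, derivative_X_pow_succ, Nat.cast_add,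
          Nat.cast_one, map_add, map_natCast, map_one, zero_add,
          derivative_natCast, derivative_one, add_zero, smul_eq_C_mul, map_mul, map_ofNat]
        ring
      rw [hX, map_smul, map_sub, map_smul, map_smul, smul_eq_mul, smul_eq_mul, smul_eq_mul,
        zonalMean_X_pow_add_two, sub_self, mul_zero]

theorem zonalMean_genLegendre (hd : 2 ≤ d) {n : ℕ} (hn : n ≠ 0) (y : USphere d) :
    zonalMean y (genLegendre d n) = 0 := by
  have h := zonalMean_gegenbauer_operator y (genLegendre d n)
  rw [eq_neg_of_add_eq_zero_left (genLegendre_ode hd n), map_neg, ← smul_eq_C_mul, map_smul,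
    neg_eq_zero] at h
  exact (smul_eq_zero.1 h).resolve_left (genLegendre_eigenvalue_pos hd hn).ne'

theorem norm_mul_genLegendre_eval_le (hd : 2 ≤ d) {c : ℝ} (hc : 0 ≤ c) (n : ℕ) {t : ℝ}
    (ht : t ∈ Icc (-1 : ℝ) 1) : ‖c * (genLegendre d n).eval t‖ ≤ c := by
  rw [norm_mul, Real.norm_of_nonneg hc]
  exact mul_le_of_le_one_right hc (abs_genLegendre_eval_le_one hd n ht)

/-- `K` has on `[-1, 1]` the expansion `∑ aₙ Pₙ` in generalized Legendre polynomials, with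
nonnegative coefficients. -/
structure IsNonnegLegendreExpansion (d : ℕ) (a : ℕ → ℝ) (K : ℝ → ℝ) : Prop where
  nonneg : ∀ n, 0 ≤ a n
  hasSum : ∀ t ∈ Icc (-1 : ℝ) 1, HasSum (fun n => a n * (genLegendre d n).eval t) (K t)

namespace IsNonnegLegendreExpansion

variable {a : ℕ → ℝ} {K : ℝ → ℝ}

theorem of_tendsto (hd : 2 ≤ d) (ha : ∀ n, 0 ≤ a n)
    (h : ∀ t ∈ Icc (-1 : ℝ) 1, Filter.Tendsto
      (fun m => ∑ n ∈ Finset.range m, a n * (genLegendre d n).eval t) Filter.atTop (nhds (K t))) :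
    IsNonnegLegendreExpansion d a K where
  nonneg := ha
  hasSum t ht := by
    have h1 := h 1 (right_mem_Icc.2 (by norm_num))
    simp only [genLegendre_eval_one hd, mul_one] at h1
    have hs : Summable a := ((hasSum_iff_tendsto_nat_of_nonneg ha _).2 h1).summable
    exact (Summable.of_norm_bounded hs
      fun n => norm_mul_genLegendre_eval_le hd (ha n) n ht).hasSum_iff_tendsto_nat.2 (h t ht)

variable (h : IsNonnegLegendreExpansion d a K)
include h

theorem summable (hd : 2 ≤ d) : Summable a := by
  simpa [genLegendre_eval_one hd] using (h.hasSum 1 (right_mem_Icc.2 (by norm_num))).summable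

theorem continuousOn (hd : 2 ≤ d) : ContinuousOn K (Icc (-1) 1) :=
  (continuousOn_tsum (fun n => by fun_prop) (h.summable hd)
    fun n _ ht => norm_mul_genLegendre_eval_le hd (h.nonneg n) n ht).congr
    fun t ht => (h.hasSum t ht).tsum_eq.symm

theorem integral_inner (hd : 2 ≤ d) (x : USphere d) :
    ∫ y : USphere d, K (inner ℝ x.1 y.1) ∂sphereSigma d = a 0 := by
  have hsum : HasSum (fun n => a n * zonalMean x (genLegendre d n))
      (∫ y : USphere d, K (inner ℝ x.1 y.1) ∂sphereSigma d) := by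
    simp only [zonalMean_apply, ← integral_const_mul]
    exact hasSum_integral_of_dominated_convergence (fun n _ => a n)
      (fun n => Continuous.aestronglyMeasurable (by fun_prop))
      (fun n => .of_forall fun y =>
        norm_mul_genLegendre_eval_le hd (h.nonneg n) n (sphere_inner_mem_Icc x y))
      (.of_forall fun _ => h.summable hd) (integrable_const _)
      (.of_forall fun y => h.hasSum _ (sphere_inner_mem_Icc x y))
  have hzero : zonalMean x (genLegendre d 0) = 1 := by
    simp [zonalMean_apply, genLegendre]
  have h0 := hsum.unique (hasSum_single 0 fun n hn => by
    rw [zonalMean_genLegendre hd hn, mul_zero])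
  rwa [hzero, mul_one] at h0

theorem integral_prod_inner (hd : 2 ≤ d) :
    ∫ p, K (inner ℝ p.1.1 p.2.1) ∂(sphereSigma d).prod (sphereSigma d) = a 0 := by
  rw [integral_prod _ (integrable_of_continuous (continuous_comp_sphere_inner (h.continuousOn hd)))]
  simp [h.integral_inner hd]

theorem sub_le (hd : 2 ≤ d) (m : ℕ) {t : ℝ} (ht : t ∈ Icc (-1 : ℝ) 1) :
    K 1 - K t ≤
      (1 - t) * ∑ n ∈ Finset.Icc 1 m, a n * (n : ℝ) ^ 2 + 2 * ∑' n, a (m + 1 + n) := by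
  have hsum : HasSum (fun n => a n * (1 - (genLegendre d n).eval t)) (K 1 - K t) := by
    simpa only [genLegendre_eval_one hd, mul_sub] using
      (h.hasSum 1 (right_mem_Icc.2 (by norm_num))).sub (h.hasSum t ht)
  have hlow : ∑ n ∈ Finset.range (m + 1), a n * (1 - (genLegendre d n).eval t) ≤
      (1 - t) * ∑ n ∈ Finset.Icc 1 m, a n * (n : ℝ) ^ 2 := by
    rw [Finset.range_eq_Ico, Finset.sum_eq_sum_Ico_succ_bot (Nat.succ_pos m), Finset.mul_sum,
      genLegendre, eval_one, sub_self, mul_zero, zero_add]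
    refine Finset.sum_le_sum fun n _ => ?_
    linarith [mul_le_mul_of_nonneg_left (one_sub_genLegendre_eval_le hd n ht) (h.nonneg n)]
  have hhigh : ∑' n, a (n + (m + 1)) * (1 - (genLegendre d (n + (m + 1))).eval t) ≤
      ∑' n, 2 * a (n + (m + 1)) := by
    refine ((summable_nat_add_iff (m + 1)).2 hsum.summable).tsum_le_tsum (fun n => ?_)
      (((summable_nat_add_iff (m + 1)).2 (h.summable hd)).mul_left 2)
    have hle := neg_le_of_abs_le (abs_genLegendre_eval_le_one hd (n + (m + 1)) ht)
    rw [mul_comm]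
    exact mul_le_mul_of_nonneg_right (by linarith) (h.nonneg _)
  rw [← hsum.tsum_eq, ← hsum.summable.sum_add_tsum_nat_add (m + 1)]
  rw [tsum_mul_left] at hhigh
  simp only [add_comm (m + 1)]
  exact add_le_add hlow hhigh

end IsNonnegLegendreExpansion

end LegendreExpansions

section IndependentSampling

open MeasureTheory

variable {ι α : Type*} [Fintype ι] [MeasurableSpace α]

theorem integral_sum_prod_sum {ι' β : Type*} [Fintype ι'] [MeasurableSpace β] {μ : ι → Measure α}
    {ν : ι' → Measure β} [∀ j, SFinite (ν j)] {k : α × β → ℝ}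
    (hk : ∀ i j, Integrable k ((μ i).prod (ν j))) :
    ∫ p, k p ∂(∑ i, μ i).prod (∑ j, ν j) = ∑ i, ∑ j, ∫ p, k p ∂(μ i).prod (ν j) := by
  rw [← Measure.sum_fintype, ← Measure.sum_fintype, Measure.prod_sum, Measure.sum_fintype,
    integral_finsetSum_measure fun p _ => hk p.1 p.2, Fintype.sum_prod_type]

theorem measurePreserving_eval_prodMk {X : ι → Type*} [∀ i, MeasurableSpace (X i)]
    (ν : ∀ i, Measure (X i)) [∀ i, IsProbabilityMeasure (ν i)] {i j : ι} (hij : i ≠ j) :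
    MeasurePreserving (fun x : ∀ i, X i => (x i, x j)) (Measure.pi ν) ((ν i).prod (ν j)) where
  measurable := by fun_prop
  map_eq := by
    have h := (ProbabilityTheory.iIndepFun_pi (μ := ν) (X := fun _ => id)
      fun _ => aemeasurable_id).indepFun hij
    simp only [id] at h
    rw [ProbabilityTheory.indepFun_iff_map_prod_eq_prod_map_map
      (measurable_pi_apply i).aemeasurable (measurable_pi_apply j).aemeasurable] at h
    exact h.trans (congrArg₂ Measure.prod (measurePreserving_eval ν i).map_eq
      (measurePreserving_eval ν j).map_eq)

variable {ν : ι → Measure α} [∀ i, IsProbabilityMeasure (ν i)] {k : α × α → ℝ}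
  (hk : ∀ i j, Integrable k ((ν i).prod (ν j))) (hdiag : ∀ i, Integrable (fun x => k (x, x)) (ν i))
include hk hdiag

theorem integrable_pi_eval_prodMk (i j : ι) :
    Integrable (fun x : ι → α => k (x i, x j)) (Measure.pi ν) := by
  rcases eq_or_ne i j with rfl | hij
  · exact (measurePreserving_eval ν i).integrable_comp_of_integrable (hdiag i)
  · exact (measurePreserving_eval_prodMk ν hij).integrable_comp_of_integrable (hk i j)

theorem integral_pi_sum_sum :
    ∫ x, ∑ i, ∑ j, k (x i, x j) ∂Measure.pi ν = ∫ p, k p ∂(∑ i, ν i).prod (∑ i, ν i) +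
      ∑ i, (∫ x, k (x, x) ∂ν i - ∫ p, k p ∂(ν i).prod (ν i)) := by
  classical
  have hpair : ∀ i j, ∫ x, k (x i, x j) ∂Measure.pi ν = ∫ p, k p ∂(ν i).prod (ν j) +
      if i = j then ∫ x, k (x, x) ∂ν i - ∫ p, k p ∂(ν i).prod (ν i) else 0 := by
    intro i j
    split_ifs with hij
    · subst hij
      rw [add_sub_cancel]
      exact (measurePreserving_eval ν i).hasLaw.integral_comp (hdiag i).aestronglyMeasurable
    · rw [add_zero]
      exact (measurePreserving_eval_prodMk ν hij).hasLaw.integral_comp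
        (hk i j).aestronglyMeasurable
  have hint := integrable_pi_eval_prodMk hk hdiag
  rw [integral_finsetSum _ fun i _ => integrable_finsetSum _ fun j _ => hint i j]
  simp only [integral_finsetSum _ fun j _ => hint _ j, hpair, Finset.sum_add_distrib,
    integral_sum_prod_sum hk, Finset.sum_ite_eq, Finset.mem_univ, if_true]

end IndependentSampling

theorem continuous_energy {d N : ℕ} {K : ℝ → ℝ} (hK : ContinuousOn K (Set.Icc (-1) 1)) :
    Continuous (energy d N K) := by
  have hk := continuous_comp_sphere_inner (d := d) hK
  exact continuous_const.mul <| continuous_finsetSum _ fun i _ => continuous_finsetSum _ fun j _ =>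
    hk.comp (by fun_prop : Continuous fun x : Fin N → USphere d => (x i, x j))

namespace IsAreaRegularPartition

open MeasureTheory

variable {d N : ℕ} {A : Fin N → Set (USphere d)} (hA : IsAreaRegularPartition d N A)
include hA

theorem pos : 0 < N := by
  rcases N.eq_zero_or_pos with rfl | h
  · simpa using congrArg (sphereSigma d) hA.covers
  · exact h

theorem isProbabilityMeasure (i : Fin N) : IsProbabilityMeasure (regionMeasure d N (A i)) where
  measure_univ := by
    rw [regionMeasure, Measure.smul_apply, Measure.restrict_apply_univ, hA.area, smul_eq_mul]
    exact ENNReal.mul_inv_cancel (by exact_mod_cast hA.pos.ne') (ENNReal.natCast_ne_top N)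

theorem sum_regionMeasure : ∑ i, regionMeasure d N (A i) = (N : ℝ≥0∞) • sphereSigma d := by
  have h := Measure.restrict_iUnion (μ := sphereSigma d)
    (fun i j hij => Set.disjoint_iff_inter_eq_empty.2 (hA.disjoint i j hij)) hA.measurable
  rw [hA.covers, Measure.restrict_univ, Measure.sum_fintype] at h
  simp only [regionMeasure, ← Finset.smul_sum, ← h]

theorem ae_regionMeasure_prod_mem (i : Fin N) :
    ∀ᵐ p ∂(regionMeasure d N (A i)).prod (regionMeasure d N (A i)), p.1 ∈ A i ∧ p.2 ∈ A i := by
  have := hA.isProbabilityMeasure i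
  have hmem : ∀ᵐ x ∂regionMeasure d N (A i), x ∈ A i :=
    Measure.ae_smul_measure (ae_restrict_mem (hA.measurable i)) _
  exact (Measure.quasiMeasurePreserving_fst.ae hmem).and
    (Measure.quasiMeasurePreserving_snd.ae hmem)

variable {K : ℝ → ℝ}

theorem integrable_energy (hK : ContinuousOn K (Set.Icc (-1) 1)) :
    Integrable (energy d N K) (jitteredLaw d N A) := by
  have := hA.isProbabilityMeasure
  unfold jitteredLaw
  exact integrable_of_continuous (continuous_energy hK)

theorem integral_energy (hK : ContinuousOn K (Set.Icc (-1) 1)) :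
    ∫ x, energy d N K x ∂jitteredLaw d N A =
      ∫ p, K (inner ℝ p.1.1 p.2.1) ∂(sphereSigma d).prod (sphereSigma d) +
        1 / (N : ℝ) ^ 2 * ∑ i, ∫ p, (K 1 - K (inner ℝ p.1.1 p.2.1))
          ∂(regionMeasure d N (A i)).prod (regionMeasure d N (A i)) := by
  have := hA.isProbabilityMeasure
  have hN : (N : ℝ) ≠ 0 := by exact_mod_cast hA.pos.ne'
  have hkc := continuous_comp_sphere_inner (d := d) hK
  have hint : ∀ i j, Integrable (fun p : USphere d × USphere d => K (inner ℝ p.1.1 p.2.1))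
      ((regionMeasure d N (A i)).prod (regionMeasure d N (A j))) := fun i j =>
    integrable_of_continuous hkc
  simp only [energy, jitteredLaw, integral_const_mul]
  rw [integral_pi_sum_sum (k := fun p : USphere d × USphere d => K (inner ℝ p.1.1 p.2.1)) hint
    fun i => integrable_of_continuous (hkc.comp (by fun_prop : Continuous fun x => (x, x))),
    hA.sum_regionMeasure, Measure.prod_smul_left, Measure.prod_smul_right, smul_smul,
    integral_smul_measure]
  simp only [integral_sub (integrable_const _) (hint _ _)]
  simp only [real_inner_self_eq_norm_sq, norm_eq_of_mem_sphere, one_pow, integral_const,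
    probReal_univ, ENNReal.toReal_mul, ENNReal.toReal_natCast, smul_eq_mul]
  field_simp

theorem integral_sub_inner_le {a : ℕ → ℝ} (hd : 2 ≤ d) (h : IsNonnegLegendreExpansion d a K)
    {δ : ℝ} {i : Fin N} (hδ : Metric.diam (A i) ≤ δ) (m : ℕ) :
    ∫ p, (K 1 - K (inner ℝ p.1.1 p.2.1))
        ∂(regionMeasure d N (A i)).prod (regionMeasure d N (A i)) ≤
      δ ^ 2 / 2 * ∑ n ∈ Finset.Icc 1 m, a n * (n : ℝ) ^ 2 + 2 * ∑' n, a (m + 1 + n) := by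
  have := hA.isProbabilityMeasure i
  set S := ∑ n ∈ Finset.Icc 1 m, a n * (n : ℝ) ^ 2
  set T := ∑' n, a (m + 1 + n)
  have hS : 0 ≤ S := Finset.sum_nonneg fun n _ => mul_nonneg (h.nonneg n) (sq_nonneg _)
  have hosc : ∀ x ∈ A i, ∀ y ∈ A i, K 1 - K (inner ℝ x.1 y.1) ≤ δ ^ 2 / 2 * S + 2 * T := by
    intro x hx y hy
    have hxy : dist x y ≤ δ :=
      (Metric.dist_le_diam_of_mem Metric.isBounded_of_compactSpace hx hy).trans hδ
    calc K 1 - K (inner ℝ x.1 y.1) ≤ dist x y ^ 2 / 2 * S + 2 * T := by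
          rw [← one_sub_sphere_inner]
          exact h.sub_le hd m (sphere_inner_mem_Icc x y)
      _ ≤ δ ^ 2 / 2 * S + 2 * T := by gcongr
  have hkc := continuous_comp_sphere_inner (d := d) (h.continuousOn hd)
  refine (integral_mono_ae (integrable_of_continuous (continuous_const.sub hkc))
    (integrable_const (δ ^ 2 / 2 * S + 2 * T)) ?_).trans_eq (by simp)
  filter_upwards [hA.ae_regionMeasure_prod_mem i] with p hp
  exact hosc p.1 hp.1 p.2 hp.2

theorem integral_energy_sub_le {a : ℕ → ℝ} (hd : 2 ≤ d) (h : IsNonnegLegendreExpansion d a K)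
    {δ : ℝ} (hδ : ∀ i, Metric.diam (A i) ≤ δ) (m : ℕ) :
    (∫ x, energy d N K x ∂jitteredLaw d N A) - a 0 ≤
      1 / N * (δ ^ 2 / 2 * ∑ n ∈ Finset.Icc 1 m, a n * (n : ℝ) ^ 2 + 2 * ∑' n, a (m + 1 + n)) := by
  have hN : (N : ℝ) ≠ 0 := by exact_mod_cast hA.pos.ne'
  set B := δ ^ 2 / 2 * ∑ n ∈ Finset.Icc 1 m, a n * (n : ℝ) ^ 2 + 2 * ∑' n, a (m + 1 + n)
  rw [hA.integral_energy (h.continuousOn hd), h.integral_prod_inner hd, add_sub_cancel_left]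
  calc 1 / (N : ℝ) ^ 2 * ∑ i, ∫ p, (K 1 - K (inner ℝ p.1.1 p.2.1))
          ∂(regionMeasure d N (A i)).prod (regionMeasure d N (A i))
      ≤ 1 / (N : ℝ) ^ 2 * ∑ _i : Fin N, B := by
        gcongr with i
        exact hA.integral_sub_inner_le hd h (hδ i) m
    _ = 1 / N * B := by
        rw [Finset.sum_const, Finset.card_univ, Fintype.card_fin, nsmul_eq_mul]
        field_simp

end IsAreaRegularPartition

theorem theorem2 (d : ℕ) (hd : 2 ≤ d) (C : ℝ) (hC : 0 < C) :
    ∃ Cd : ℝ, 0 < Cd ∧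
      ∀ (a : ℕ → ℝ) (K : ℝ → ℝ), (∀ n, 0 ≤ a n) → ContinuousOn K (Set.Icc (-1) 1) →
        (∀ t ∈ Set.Icc (-1 : ℝ) 1,
          Filter.Tendsto (fun m => ∑ n ∈ Finset.range m, a n * (genLegendre d n).eval t)
            Filter.atTop (nhds (K t))) →
        ∀ (N : ℕ) (A : Fin N → Set (USphere d)), IsAreaRegularPartition d N A →
          (∀ i, Metric.diam (A i) ≤ C * (N : ℝ) ^ (-(1 / (d : ℝ)))) →
          Summable a ∧
          MeasureTheory.Integrable (energy d N K) (jitteredLaw d N A) ∧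
          (∫ x, energy d N K x ∂(jitteredLaw d N A)) - a 0 ≤
            Cd / N *
              ((N : ℝ) ^ (-(2 / (d : ℝ))) *
                  ∑ n ∈ Finset.Icc 1 ⌊(N : ℝ) ^ (1 / (d : ℝ))⌋₊, a n * (n : ℝ) ^ 2
                + ∑' n : ℕ, a (⌊(N : ℝ) ^ (1 / (d : ℝ))⌋₊ + 1 + n)) := by
  refine ⟨C ^ 2 / 2 + 2, by positivity, fun a K ha hK hlim N A hA hdiam => ?_⟩
  have h := IsNonnegLegendreExpansion.of_tendsto hd ha hlim
  refine ⟨h.summable hd, hA.integrable_energy hK, ?_⟩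
  set m := ⌊(N : ℝ) ^ (1 / (d : ℝ))⌋₊
  set S := ∑ n ∈ Finset.Icc 1 m, a n * (n : ℝ) ^ 2
  set T := ∑' n : ℕ, a (m + 1 + n)
  have hS : 0 ≤ S := Finset.sum_nonneg fun n _ => mul_nonneg (ha n) (sq_nonneg _)
  have hT : 0 ≤ T := tsum_nonneg fun n => ha _
  have hscale : (C * (N : ℝ) ^ (-(1 / (d : ℝ)))) ^ 2 = C ^ 2 * (N : ℝ) ^ (-(2 / (d : ℝ))) := by
    rw [mul_pow, ← Real.rpow_mul_natCast N.cast_nonneg]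
    ring_nf
  calc (∫ x, energy d N K x ∂jitteredLaw d N A) - a 0
      ≤ 1 / N * ((C * (N : ℝ) ^ (-(1 / (d : ℝ)))) ^ 2 / 2 * S + 2 * T) :=
        hA.integral_energy_sub_le hd h hdiam m
    _ ≤ 1 / N * ((C ^ 2 / 2 + 2) * ((N : ℝ) ^ (-(2 / (d : ℝ))) * S + T)) := by
        rw [hscale]
        have hNS : 0 ≤ (N : ℝ) ^ (-(2 / (d : ℝ))) * S := by positivity
        have hCT : 0 ≤ C ^ 2 / 2 * T := by positivity
        gcongr
        linarith
    _ = (C ^ 2 / 2 + 2) / N * ((N : ℝ) ^ (-(2 / (d : ℝ))) * S + T) := by ring
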